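/- Let $0<\alpha<1$. For a function $u$ that is absolutely continuous on $[0,L]$ for every $L>0$, let $$D^\alpha_C u(x)=\frac1{\Gamma(1-\alpha)}\int_0^x\frac{u'(s)}{(x-s)^{\alpha}}\,ds$$ be its Caputo derivative of order $\alpha$; for functions of $(x,t)$ it acts in the variable $x$. Let $$E_{\alpha,1+1/\alpha,1/\alpha}(z)=\sum_{n=0}^\infty c_n z^n,\qquad c_n=\prod_{i=0}^{n-1}\frac{\Gamma((1+\alpha)i+2)}{\Gamma((1+\alpha)i+2+\alpha)},$$ be the three-parameter generalized Mittag-Leffler function $E_{\beta,m,l}$ with $\beta=\alpha$, $m=1+1/\alpha$, $l=1/\alpha$, and let $$\mathcal E(x,t)=a_0\,t^{-\frac1{1+\alpha}}E_{\alpha,1+1/\alpha,1/\alpha}\Bigl(-\frac{x^{1+\alpha}}{(1+\alpha)t}\Bigr),\qquad \frac1{a_0}=2\int_0^\infty E_{\alpha,1+1/\alpha,1/\alpha}\Bigl(-\frac{x^{1+\alpha}}{1+\alpha}\Bigr)dx .$$ Then $\mathcal E$ is well defined: the series converges for every $z\in\mathbb R$, and the integral defining $a_0$ converges absolutely and is positive.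 Moreover: 1. $\mathcal E\in C^2((0,\infty)^2)$, and $\mathcal E$ is a classical solution of $$u_t-\partial_x D^\alpha_C u=0\quad\text{on }(0,\infty)^2,$$ that is, for every $t>0$ the function $\mathcal E(\cdot,t)$ (extended to $x=0$ by the same formula) is absolutely continuous on each $[0,L]$, the integral defining $D^\alpha_C\mathcal E(\cdot,t)$ converges absolutely at every $x>0$, and the derivatives $\mathcal E_t$ and $\partial_xD^\alpha_C\mathcal E$ exist and are equal at every point of $(0,\infty)^2$. It is self-similar: for every $\lambda>0$, $$\lambda^{\frac1{1+\alpha}}\,\mathcal E\bigl(\lambda^{\frac1{1+\alpha}}x,\lambda t\bigr)=\mathcal E(x,t)\quad\text{for all }x,t>0,$$ and $(x,t)\mapsto\mathcal E(\lambda^{\frac1{1+\alpha}}x,\lambda t)$ is again a classical solution. 2. $\mathcal E(x,t)>0$ for all $x,t>0$. 3. For every $t>0$ the function $\mathcal E(\cdot,t)$ is strictly decreasing on $(0,\infty)$. 4. For every $t>0$, $\mathcal E(\cdot,t)\in L^1(0,\infty)$ and $\int_0^\infty\mathcal E(x,t)\,dx=\frac12$. -/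

import Mathlib

open Set MeasureTheory

noncomputable section

/-- Coefficients `c_n` of the three-parameter generalized Mittag-Leffler (Kilbas-Saigo) function,
`c_n = ∏_{i<n} Γ(β(im + l) + 1) / Γ(β(im + l + 1) + 1)`, for real parameters. -/
def mittagLefflerCoeff (β m l : ℝ) (n : ℕ) : ℝ :=
  ∏ i ∈ Finset.range n,
    Real.Gamma (β * (i * m + l) + 1) / Real.Gamma (β * (i * m + l + 1) + 1)

/-- The three-parameter generalized Mittag-Leffler function `E_{β,m,l}(z) = ∑ c_n z^n`,
restricted to real parameters and real arguments. -/
def mittagLeffler (β m l z : ℝ) : ℝ :=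
  ∑' n : ℕ, mittagLefflerCoeff β m l n * z ^ n

/-- The fractional integral
`(I^γ f)(x) = (1 / Γ(γ)) ∫_0^x (x - z)^(γ - 1) f(z) dz`. -/
def fractionalIntegral (γ : ℝ) (f : ℝ → ℝ) (x : ℝ) : ℝ :=
  (1 / Real.Gamma γ) * ∫ z in (0 : ℝ)..x, (x - z) ^ (γ - 1) * f z

/-- The Caputo derivative `D^α_C u = I^{1-α} u'` of order `α ∈ (0,1)`, based at `0`.
It only involves the values of `u'` on `(0,x)`. -/
def caputoDeriv (α : ℝ) (u : ℝ → ℝ) (x : ℝ) : ℝ :=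
  fractionalIntegral (1 - α) (deriv u) x

/-- Classical (pointwise) solutions of `u_t - ∂_x D^α_C u = 0` on `(0,∞)²`, where `D^α_C` acts on
the space variable. For each `t > 0` the function `u(·,t)` is absolutely continuous on every
`[0,L]` and the integral defining `D^α_C u(·,t)` converges at every point, so that the Caputo
derivative makes sense; the derivatives `u_t` and `∂_x D^α_C u` exist at every point, and the
equation holds there. -/
structure IsClassicalSolution (α : ℝ) (u : ℝ → ℝ → ℝ) : Prop where
  absolutelyContinuous : ∀ t : ℝ, 0 < t → ∀ L : ℝ, 0 < L →
    AbsolutelyContinuousOnInterval (fun x => u x t) 0 L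
  intervalIntegrable : ∀ t : ℝ, 0 < t → ∀ x : ℝ, 0 < x →
    IntervalIntegrable (fun z => (x - z) ^ ((1 - α) - 1) * deriv (fun y => u y t) z) volume 0 x
  differentiableAt_time : ∀ x t : ℝ, 0 < x → 0 < t →
    DifferentiableAt ℝ (fun s => u x s) t
  differentiableAt_caputo : ∀ x t : ℝ, 0 < x → 0 < t →
    DifferentiableAt ℝ (caputoDeriv α (fun y => u y t)) x
  equation : ∀ x t : ℝ, 0 < x → 0 < t →
    deriv (fun s => u x s) t - deriv (caputoDeriv α (fun y => u y t)) x = 0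

/-- The profile `Φ(x) = E_{α, 1+1/α, 1/α}(-x^{1+α} / (1+α))`. -/
def selfSimilarProfile (α x : ℝ) : ℝ :=
  mittagLeffler α (1 + 1 / α) (1 / α) (-(x ^ (1 + α)) / (1 + α))

/-- The constant `a₀`, given by `1 / a₀ = 2 ∫_0^∞ E_{α, 1+1/α, 1/α}(-x^{1+α} / (1+α)) dx`. -/
def normalizingConst (α : ℝ) : ℝ :=
  1 / (2 * ∫ x in Ioi (0 : ℝ), selfSimilarProfile α x)

/-- `𝓔(x,t) = a₀ t^{-1/(1+α)} E_{α, 1+1/α, 1/α}(-x^{1+α} / ((1+α) t))`; the same formula gives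
the boundary values at `x = 0`. -/
def fundamentalSol (α x t : ℝ) : ℝ :=
  normalizingConst α * t ^ (-(1 / (1 + α))) *
    mittagLeffler α (1 + 1 / α) (1 / α) (-(x ^ (1 + α)) / ((1 + α) * t))

end

noncomputable section

open Filter Topology Interval

/-! Let Φ be the profile, a power series in `x ^ (1 + α)`. The Euler beta integral lets fractional
integrals act termwise on such series, and the recursion for the coefficients says exactly that
I^{1-α} Φ' = -xΦ/(1+α) (`fractionalIntegral_profileDeriv`). Put k = t^{-1/(1+α)} and u = A k Φ(kx).
Scaling turns this identity into D^α_C u = -x u/((1+α)t). Since dk/dt = -k/((1+α)t) and k ∂_k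
(kΦ(kx)) = ∂_x (x kΦ(kx)), the x-derivative of the right-hand side is u_t, which is the equation.

Signs come from an extremum principle (`integral_sub_rpow_mul_deriv_le`) applied at a first zero. A
first zero of Φ would make the Caputo derivative there strictly negative, while the profile equation
makes it 0. A first zero of -Φ' would make the Caputo derivative of -Φ' nonpositive, while the
differentiated equation makes it a positive multiple of Φ.

Integrability uses the inverted equation Φ = 1 - I^α(xΦ)/(1+α): as Φ decreases and is positive,
I^α(xΦ) ≥ Φ(x) I^α(x), a positive multiple of x^{1+α} Φ(x), so Φ = O(x^{-(1+α)}). The value 1/2 is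
then the choice of a₀ together with the substitution kx. -/

/-- The sum of the real power series with coefficients `a`. -/
def powerSeriesSum (a : ℕ → ℝ) (z : ℝ) : ℝ := ∑' n, a n * z ^ n

/-- The coefficients `a` define a power series converging on all of `ℝ`. -/
def EntireCoeff (a : ℕ → ℝ) : Prop := ∀ z : ℝ, Summable fun n => a n * z ^ n

/-! ### Everywhere convergent real power series -/

namespace EntireCoeff

variable {a : ℕ → ℝ}

lemma summable_abs (ha : EntireCoeff a) (z : ℝ) : Summable fun n => |a n| * |z| ^ n := by
  simpa [abs_mul, abs_pow] using (ha z).abs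

/-- Multiplying the coefficients by an affine function of the index preserves convergence. -/
lemma affine_mul (ha : EntireCoeff a) (p q : ℝ) : EntireCoeff fun n => (q + p * n) * a n := by
  intro z
  -- Since n ≤ 2^n, the affine factor is absorbed by doubling the argument.
  have h := (ha.summable_abs (2 * (|z| + 1))).mul_left (|q| + |p|)
  refine Summable.of_norm_bounded h fun n => ?_
  have h2 : (n : ℝ) ≤ 2 ^ n := by exact_mod_cast Nat.lt_two_pow_self.le
  have h1 : (1 : ℝ) ≤ 2 ^ n := one_le_pow₀ (by norm_num)
  have h3 : |q + p * n| ≤ (|q| + |p|) * 2 ^ n := by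
    calc |q + p * n| ≤ |q| + |p * n| := abs_add_le _ _
      _ = |q| * 1 + |p| * n := by rw [abs_mul, Nat.abs_cast, mul_one]
      _ ≤ |q| * 2 ^ n + |p| * 2 ^ n := by gcongr
      _ = _ := by ring
  have h4 : |z| ^ n ≤ (|z| + 1) ^ n := by gcongr; linarith
  rw [abs_of_nonneg (by positivity : 0 ≤ 2 * (|z| + 1)), mul_pow, Real.norm_eq_abs, abs_mul,
    abs_mul, abs_pow]
  calc |q + p * n| * |a n| * |z| ^ n ≤ ((|q| + |p|) * 2 ^ n) * |a n| * (|z| + 1) ^ n := by gcongr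
    _ = _ := by ring

lemma shift (ha : EntireCoeff a) : EntireCoeff fun n => a (n + 1) := by
  intro z
  rcases eq_or_ne z 0 with rfl | hz
  · refine summable_of_ne_finset_zero (s := {0}) fun n hn => ?_
    simp at hn
    simp [hn]
  · have := ((summable_nat_add_iff 1).2 (ha z)).mul_right z⁻¹
    refine this.congr fun n => ?_
    rw [pow_succ]
    field_simp

lemma derivCoeff (ha : EntireCoeff a) : EntireCoeff fun n => ((n : ℝ) + 1) * a (n + 1) := by
  simpa [add_comm] using ha.shift.affine_mul 1 1

/-- Termwise differentiation on the ball of radius |z| + 1, where the differentiated series is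
dominated by its absolute values at the radius. -/
lemma hasDerivAt (ha : EntireCoeff a) (z : ℝ) :
    HasDerivAt (powerSeriesSum a) (powerSeriesSum (fun n => ((n : ℝ) + 1) * a (n + 1)) z) z := by
  set R : ℝ := |z| + 1 with hR
  have hRpos : 0 < R := by positivity
  have hsum : Summable fun n : ℕ => |(n : ℝ) * a n| * R ^ (n - 1) := by
    rw [← summable_nat_add_iff 1]
    refine (ha.derivCoeff.summable_abs R).congr fun n => ?_
    simp [abs_of_pos hRpos]
  have key := hasDerivAt_tsum_of_isPreconnected (𝕜 := ℝ) (g := fun n y => a n * y ^ n)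
    (g' := fun n y => a n * (n * y ^ (n - 1))) (t := Metric.ball 0 R) (y₀ := 0) (y := z) hsum
    Metric.isOpen_ball (convex_ball _ _).isPreconnected
    (fun n y _ => (hasDerivAt_pow n y).const_mul (a n))
    (fun n y hy => by
      have hy' : |y| ≤ R := by simpa using (Metric.mem_ball.1 hy).le
      rw [Real.norm_eq_abs, ← mul_assoc, abs_mul, abs_pow, mul_comm (a n)]
      gcongr) (by simpa using hRpos) (ha 0)
    (by simp [hR])
  refine key.congr_deriv ?_
  have hs : Summable fun n : ℕ => a n * (n * z ^ (n - 1)) := by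
    rw [← summable_nat_add_iff 1]
    refine (ha.derivCoeff z).congr fun n => ?_
    rw [Nat.add_sub_cancel]
    push_cast
    ring
  rw [hs.tsum_eq_zero_add]
  simp only [Nat.cast_zero, zero_mul, mul_zero, zero_add, Nat.add_sub_cancel]
  refine tsum_congr fun n => ?_
  push_cast
  ring

lemma contDiff (ha : EntireCoeff a) (k : ℕ) : ContDiff ℝ k (powerSeriesSum a) := by
  induction k generalizing a with
  | zero =>
    exact contDiff_zero.2 (continuous_iff_continuousAt.2 fun z => (ha.hasDerivAt z).continuousAt)
  | succ k ih =>
    have hd : deriv (powerSeriesSum a) = powerSeriesSum fun n => ((n : ℝ) + 1) * a (n + 1) :=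
      funext fun z => (ha.hasDerivAt z).deriv
    push_cast
    rw [contDiff_succ_iff_deriv]
    refine ⟨fun z => (ha.hasDerivAt z).differentiableAt, by simp, ?_⟩
    rw [hd]
    exact ih ha.derivCoeff

lemma continuous (ha : EntireCoeff a) : Continuous (powerSeriesSum a) :=
  (ha.contDiff 0).continuous

end EntireCoeff

/-! ### Fractional power series and their derivatives -/

/-- The fractional power series `x ^ q * ∑ a_n x ^ (β n)`. -/
def fracPowerSeries (β q : ℝ) (a : ℕ → ℝ) (x : ℝ) : ℝ := x ^ q * powerSeriesSum a (x ^ β)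

section fracPowerSeries

variable {a : ℕ → ℝ} {β q x : ℝ}

lemma fracPowerSeries_eq_tsum (hx : 0 < x) :
    fracPowerSeries β q a x = ∑' n, a n * x ^ (q + β * n) := by
  rw [fracPowerSeries, powerSeriesSum, ← tsum_mul_left]
  refine tsum_congr fun n => ?_
  rw [Real.rpow_add hx, Real.rpow_mul hx.le, Real.rpow_natCast]
  ring

lemma fracPowerSeries_congr {b : ℕ → ℝ} (h : ∀ n, a n = b n) :
    fracPowerSeries β q a x = fracPowerSeries β q b x := by
  rw [funext h]

lemma fracPowerSeries_const_mul (c : ℝ) :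
    fracPowerSeries β q (fun n => c * a n) x = c * fracPowerSeries β q a x := by
  rw [fracPowerSeries, fracPowerSeries, powerSeriesSum, powerSeriesSum, mul_left_comm,
    ← tsum_mul_left (a := c)]
  simp only [mul_assoc]

lemma fracPowerSeries_eq_zero_add (ha : EntireCoeff a) (hx : 0 < x) :
    fracPowerSeries β q a x =
      a 0 * x ^ q + fracPowerSeries β (q + β) (fun n => a (n + 1)) x := by
  rw [fracPowerSeries, fracPowerSeries, powerSeriesSum, powerSeriesSum, (ha _).tsum_eq_zero_add,
    Real.rpow_add hx, mul_add]
  congr 1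
  · simp [mul_comm]
  · rw [mul_assoc, ← tsum_mul_left (a := x ^ β)]
    congr 1
    refine tsum_congr fun n => ?_
    ring

/-- Product and chain rule for x^q A(x^β); the two resulting series recombine into the one obtained
by differentiating each x^{q+βn}. -/
lemma hasDerivAt_fracPowerSeries (ha : EntireCoeff a) (hx : 0 < x) :
    HasDerivAt (fracPowerSeries β q a)
      (fracPowerSeries β (q - 1) (fun n => (q + β * n) * a n) x) x := by
  have h1 := Real.hasDerivAt_rpow_const (x := x) (p := q) (Or.inl hx.ne')
  have h2 := Real.hasDerivAt_rpow_const (x := x) (p := β) (Or.inl hx.ne')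
  have h3 := (ha.hasDerivAt (x ^ β)).comp x h2
  refine (h1.mul h3).congr_deriv ?_
  have e0 : x ^ q = x ^ (q - 1) * x := by
    rw [← Real.rpow_add_one hx.ne', sub_add_cancel]
  have e1 : x ^ (β - 1) = x ^ β / x := Real.rpow_sub_one hx.ne' β
  have e2 : powerSeriesSum (fun n => (q + β * n) * a n) (x ^ β) =
      q * powerSeriesSum a (x ^ β) +
        β * x ^ β * powerSeriesSum (fun n => ((n : ℝ) + 1) * a (n + 1)) (x ^ β) := by
    have hs : Summable fun n : ℕ => (0 + 1 * (n : ℝ)) * a n * (x ^ β) ^ n :=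
      ha.affine_mul 1 0 (x ^ β)
    simp only [powerSeriesSum]
    rw [← tsum_mul_left, ← tsum_mul_left]
    have e3 : ∑' n : ℕ, β * ((0 + 1 * (n : ℝ)) * a n * (x ^ β) ^ n) =
        ∑' n : ℕ, β * x ^ β * (((n : ℝ) + 1) * a (n + 1) * (x ^ β) ^ n) := by
      rw [(hs.mul_left β).tsum_eq_zero_add]
      simp only [Nat.cast_zero, mul_zero, add_zero, zero_mul, zero_add]
      refine tsum_congr fun n => ?_
      push_cast
      ring
    rw [← e3, ← ((ha _).mul_left q).tsum_add (hs.mul_left β)]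
    refine tsum_congr fun n => ?_
    ring
  rw [fracPowerSeries, e2, e0, e1, Function.comp_apply]
  field_simp

lemma fracPowerSeries_continuous (ha : EntireCoeff a) (hβ : 0 < β) (hq : 0 ≤ q) :
    Continuous (fracPowerSeries β q a) :=
  (Real.continuous_rpow_const hq).mul (ha.continuous.comp (Real.continuous_rpow_const hβ.le))

end fracPowerSeries

/-! ### Beta integrals and termwise fractional integration -/

section beta

variable {γ p x : ℝ}

/-- Each endpoint may be singular, so the interval is cut at x/2: on each half one factor is
continuous and the other is an integrable power. -/
lemma intervalIntegrable_sub_rpow_mul_rpow (hγ : 0 < γ) (hp : -1 < p) (hx : 0 < x) :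
    IntervalIntegrable (fun s => (x - s) ^ (γ - 1) * s ^ p) volume 0 x := by
  have h1 : IntervalIntegrable (fun s => (x - s) ^ (γ - 1) * s ^ p) volume 0 (x / 2) := by
    refine IntervalIntegrable.continuousOn_mul (intervalIntegral.intervalIntegrable_rpow' hp) ?_
    refine ContinuousOn.rpow_const (by fun_prop) fun s hs => Or.inl ?_
    rw [uIcc_of_le (by positivity)] at hs
    have := hs.2
    linarith
  have h0 : IntervalIntegrable (fun s : ℝ => (x - s) ^ (γ - 1)) volume (x / 2) x := by
    have := (intervalIntegral.intervalIntegrable_rpow' (a := 0) (b := x / 2)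
      (show -1 < γ - 1 by linarith)).comp_sub_left x
    have e : x - x / 2 = x / 2 := by ring
    simpa [e] using this.symm
  have h2 : IntervalIntegrable (fun s => (x - s) ^ (γ - 1) * s ^ p) volume (x / 2) x := by
    refine IntervalIntegrable.mul_continuousOn h0 ?_
    refine ContinuousOn.rpow_const (by fun_prop) fun s hs => Or.inl ?_
    rw [uIcc_of_le (by linarith)] at hs
    have := hs.1
    have : 0 < s := by linarith
    exact this.ne'
  exact h1.trans h2

lemma integral_sub_rpow_mul_rpow (hγ : 0 < γ) (hp : -1 < p) (hx : 0 < x) :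
    ∫ s in (0 : ℝ)..x, (x - s) ^ (γ - 1) * s ^ p =
      Real.Gamma γ * (Real.Gamma (p + 1) / Real.Gamma (p + 1 + γ)) * x ^ (p + γ) := by
  have h := Complex.betaIntegral_scaled ((p + 1 : ℝ) : ℂ) (γ : ℂ) hx
  have e1 : ∫ s in (0 : ℝ)..x, ((s : ℂ) ^ (((p + 1 : ℝ) : ℂ) - 1) * ((x : ℂ) - s) ^ ((γ : ℂ) - 1)) =
      ((∫ s in (0 : ℝ)..x, (x - s) ^ (γ - 1) * s ^ p : ℝ) : ℂ) := by
    rw [← intervalIntegral.integral_ofReal]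
    refine intervalIntegral.integral_congr fun s hs => ?_
    rw [uIcc_of_le hx.le] at hs
    rw [Complex.ofReal_mul, Complex.ofReal_cpow (by linarith [hs.2]), Complex.ofReal_cpow hs.1]
    push_cast
    rw [add_sub_cancel_right, mul_comm]
  have hG := Complex.Gamma_mul_Gamma_eq_betaIntegral (s := ((p + 1 : ℝ) : ℂ)) (t := (γ : ℂ))
    (by simp; linarith) (by simpa using hγ)
  rw [← Complex.ofReal_add, Complex.Gamma_ofReal, Complex.Gamma_ofReal, Complex.Gamma_ofReal] at hG
  have hne : Real.Gamma (p + 1 + γ) ≠ 0 := (Real.Gamma_pos_of_pos (by linarith)).ne'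
  have hB : Complex.betaIntegral ((p + 1 : ℝ) : ℂ) (γ : ℂ) =
      ((Real.Gamma (p + 1) * Real.Gamma γ / Real.Gamma (p + 1 + γ) : ℝ) : ℂ) := by
    rw [Complex.ofReal_div, Complex.ofReal_mul, hG, mul_div_cancel_left₀]
    exact_mod_cast hne
  have e2 : (x : ℂ) ^ (((p + 1 : ℝ) : ℂ) + (γ : ℂ) - 1) = ((x ^ (p + γ) : ℝ) : ℂ) := by
    rw [Complex.ofReal_cpow hx.le]
    congr 1
    push_cast
    ring
  rw [e1, hB, e2] at h
  have h' : ∫ s in (0 : ℝ)..x, (x - s) ^ (γ - 1) * s ^ p =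
      x ^ (p + γ) * (Real.Gamma (p + 1) * Real.Gamma γ / Real.Gamma (p + 1 + γ)) := by
    exact_mod_cast h
  rw [h']
  ring

variable {a : ℕ → ℝ} {β q : ℝ}

lemma intervalIntegrable_sub_rpow_mul_fracPowerSeries (ha : EntireCoeff a) (hβ : 0 < β)
    (hγ : 0 < γ) (hq : -1 < q) (hx : 0 < x) :
    IntervalIntegrable (fun s => (x - s) ^ (γ - 1) * fracPowerSeries β q a s) volume 0 x := by
  have := (intervalIntegrable_sub_rpow_mul_rpow hγ hq hx).mul_continuousOn
    (g := fun s => powerSeriesSum a (s ^ β))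
    (ha.continuous.comp (Real.continuous_rpow_const hβ.le)).continuousOn
  simpa only [fracPowerSeries, mul_assoc] using this

/-- Termwise fractional integration of a fractional power series. -/
lemma fractionalIntegral_fracPowerSeries (ha : EntireCoeff a) (hβ : 0 < β)
    (hγ : 0 < γ) (hq : -1 < q) (hx : 0 < x) :
    fractionalIntegral γ (fracPowerSeries β q a) x =
      fracPowerSeries β (q + γ)
        (fun n => Real.Gamma (q + β * n + 1) / Real.Gamma (q + β * n + 1 + γ) * a n) x := by
  have hint := intervalIntegrable_sub_rpow_mul_rpow hγ hq hx
  have hmem : ∀ s ∈ Ι (0 : ℝ) x, 0 < s ∧ s ≤ x := fun s hs => by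
    rwa [uIoc_of_le hx.le] at hs
  have key := intervalIntegral.hasSum_integral_of_dominated_convergence (μ := volume)
    (a := 0) (b := x)
    (F := fun n s => a n * ((x - s) ^ (γ - 1) * s ^ (q + β * n)))
    (f := fun s => (x - s) ^ (γ - 1) * fracPowerSeries β q a s)
    -- Dominated convergence: s^{βn} ≤ x^{βn} on (0, x], so the bounds sum to a constant times an
    -- integrable kernel.
    (bound := fun n s => (|a n| * (x ^ β) ^ n) * ((x - s) ^ (γ - 1) * s ^ q))
    (fun n => by
      apply Measurable.aestronglyMeasurable
      fun_prop)
    (fun n => Eventually.of_forall fun s hs => by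
      obtain ⟨h1, h2⟩ := hmem s hs
      rw [Real.rpow_add h1, Real.rpow_mul h1.le, Real.rpow_natCast, norm_mul, Real.norm_eq_abs,
        Real.norm_of_nonneg (mul_nonneg (Real.rpow_nonneg (by linarith) _) (by positivity))]
      have h3 : (s ^ β) ^ n ≤ (x ^ β) ^ n := by gcongr
      have h4 : 0 ≤ (x - s) ^ (γ - 1) := Real.rpow_nonneg (by linarith) _
      calc |a n| * ((x - s) ^ (γ - 1) * (s ^ q * (s ^ β) ^ n))
          ≤ |a n| * ((x - s) ^ (γ - 1) * (s ^ q * (x ^ β) ^ n)) := by gcongr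
        _ = _ := by ring)
    (Eventually.of_forall fun s _ => by
      refine Summable.mul_right _ ?_
      simpa [abs_of_pos (Real.rpow_pos_of_pos hx β)] using ha.summable_abs (x ^ β))
    (by
      simp_rw [tsum_mul_right]
      exact hint.const_mul _)
    (Eventually.of_forall fun s hs => by
      obtain ⟨h1, h2⟩ := hmem s hs
      rw [fracPowerSeries]
      refine ((((ha (s ^ β)).hasSum).mul_left (s ^ q)).mul_left _).congr_fun ?_
      intro n
      rw [Real.rpow_add h1, Real.rpow_mul h1.le, Real.rpow_natCast]
      ring)
  rw [fractionalIntegral, ← key.tsum_eq, fracPowerSeries_eq_tsum hx, ← tsum_mul_left]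
  refine tsum_congr fun n => ?_
  have hn : 0 ≤ β * n := by positivity
  rw [intervalIntegral.integral_const_mul, integral_sub_rpow_mul_rpow hγ (by linarith) hx,
    show q + γ + β * n = q + β * n + γ by ring]
  have := (Real.Gamma_pos_of_pos hγ).ne'
  field_simp

end beta


/-! ### First zeros and the extremum principle -/

/-- A function positive near `0⁺` that is not positive on all of `(0, ∞)` has a first zero. -/
lemma exists_first_zero {f : ℝ → ℝ} (hf : ContinuousOn f (Ioi 0))
    (hpos : ∀ᶠ x in 𝓝[>] (0 : ℝ), 0 < f x) {x₁ : ℝ} (hx₁ : 0 < x₁) (h : f x₁ ≤ 0) :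
    ∃ x₀, 0 < x₀ ∧ f x₀ = 0 ∧ ∀ x ∈ Ioo 0 x₀, 0 < f x := by
  obtain ⟨δ, hδ, hδf⟩ := mem_nhdsGT_iff_exists_Ioo_subset.1 hpos
  have hδ0 : (0 : ℝ) < δ := hδ
  have hδx : δ ≤ x₁ := by
    by_contra hlt
    exact absurd (hδf ⟨hx₁, not_le.1 hlt⟩ : 0 < f x₁) (not_lt.2 h)
  set S : Set ℝ := Icc δ x₁ ∩ f ⁻¹' Iic 0 with hS
  have hcl : IsClosed S :=
    (hf.mono fun x hx => hδ0.trans_le hx.1).preimage_isClosed_of_isClosed isClosed_Icc isClosed_Iic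
  have hcpt : IsCompact S := isCompact_Icc.of_isClosed_subset hcl inter_subset_left
  have hmem : sInf S ∈ S := hcpt.sInf_mem ⟨x₁, ⟨hδx, le_rfl⟩, h⟩
  have hx0 : 0 < sInf S := hδ0.trans_le hmem.1.1
  have hbelow : ∀ x ∈ Ioo 0 (sInf S), 0 < f x := by
    intro x hx
    rcases lt_or_ge x δ with hxδ | hxδ
    · exact hδf ⟨hx.1, hxδ⟩
    · by_contra hle
      exact absurd (csInf_le hcpt.bddBelow
        (show x ∈ S from ⟨⟨hxδ, hx.2.le.trans hmem.1.2⟩, not_lt.1 hle⟩)) (not_le.2 hx.2)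
  refine ⟨sInf S, hx0, le_antisymm hmem.2 ?_, hbelow⟩
  -- The value at the infimum is ≤ 0 by closedness and ≥ 0 as a limit of positive values from the
  -- left.
  have ht : Tendsto f (𝓝[<] (sInf S)) (𝓝 (f (sInf S))) :=
    ((hf.continuousAt (Ioi_mem_nhds hx0)).tendsto).mono_left nhdsWithin_le_nhds
  refine ge_of_tendsto ht ?_
  filter_upwards [Ioo_mem_nhdsLT hx0] with x hx using (hbelow x hx).le

/-- Extremum principle for the Caputo derivative: a nonnegative function vanishing at the right
endpoint has Caputo derivative at most `-x₀ ^ (-α) f 0` there, up to normalization. -/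
lemma integral_sub_rpow_mul_deriv_le {α x₀ : ℝ} (hα₀ : 0 < α) (hα₁ : α < 1) (hx₀ : 0 < x₀)
    {f f' : ℝ → ℝ} (hf : ContinuousOn f (Icc 0 x₀))
    (hf' : ∀ x ∈ Ioc 0 x₀, HasDerivAt f (f' x) x) (hf0 : f x₀ = 0)
    (hnn : ∀ x ∈ Ioo 0 x₀, 0 ≤ f x)
    (hint : IntervalIntegrable (fun s => (x₀ - s) ^ (-α) * f' s) volume 0 x₀) :
    ∫ s in (0 : ℝ)..x₀, (x₀ - s) ^ (-α) * f' s ≤ -(x₀ ^ (-α) * f 0) := by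
  set g : ℝ → ℝ := fun s => (x₀ - s) ^ (-α) * f s with hg
  have hcont : ContinuousOn g (Icc 0 x₀) := by
    intro s hs
    rcases eq_or_lt_of_le hs.2 with rfl | hlt
    · have hO := (hf' s ⟨hx₀, le_rfl⟩).differentiableAt.isBigO_sub
      have hlim : Tendsto (fun y => |s - y| ^ (1 - α)) (𝓝[Icc 0 s] s) (𝓝 0) := by
        have : Continuous fun y : ℝ => |s - y| ^ (1 - α) :=
          (continuous_const.sub continuous_id).abs.rpow_const fun _ => Or.inr (by linarith)
        have h := (this.tendsto s).mono_left (nhdsWithin_le_nhds (s := Icc 0 s))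
        simpa [Real.zero_rpow (by linarith : 1 - α ≠ 0)] using h
      obtain ⟨C, hC⟩ := hO.bound
      have hgs : g s = 0 := by simp [hg, hf0]
      rw [ContinuousWithinAt, hgs]
      refine squeeze_zero_norm' (a := fun y => C * |s - y| ^ (1 - α)) ?_
        (by simpa using hlim.const_mul C)
      filter_upwards [nhdsWithin_le_nhds hC, self_mem_nhdsWithin] with y hy hys
      rcases eq_or_lt_of_le hys.2 with rfl | hlt
      · simp [hgs, Real.zero_rpow (by linarith : 1 - α ≠ 0)]
      · have hpos : 0 < s - y := by linarith
        have hy' : |f y| ≤ C * (s - y) := by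
          simpa [hf0, abs_sub_comm y s, abs_of_pos hpos] using hy
        rw [hg, norm_mul, Real.norm_of_nonneg (Real.rpow_nonneg hpos.le _), Real.norm_eq_abs,
          abs_of_pos hpos]
        calc (s - y) ^ (-α) * |f y| ≤ (s - y) ^ (-α) * (C * (s - y)) := by gcongr
          _ = C * ((s - y) ^ (-α) * (s - y) ^ (1 : ℝ)) := by rw [Real.rpow_one]; ring
          _ = C * (s - y) ^ (1 - α) := by rw [← Real.rpow_add hpos]; ring_nf
    · refine ContinuousWithinAt.mul ?_ (hf s hs)
      refine ContinuousWithinAt.rpow_const (by fun_prop) (Or.inl ?_)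
      linarith
  -- Integration by parts as an inequality: the term where the kernel is differentiated is
  -- nonnegative and is dropped, so its integrability is never needed.
  have h := intervalIntegral.integral_le_sub_of_hasDeriv_right_of_le hx₀.le hcont
    (g' := fun s => α * (x₀ - s) ^ (-α - 1) * f s + (x₀ - s) ^ (-α) * f' s)
    (φ := fun s => (x₀ - s) ^ (-α) * f' s)
    (fun s hs => by
      have h1 : HasDerivAt (fun s => x₀ - s) (-1) s := by
        simpa using (hasDerivAt_id s).const_sub x₀
      have h2 := h1.rpow_const (p := -α) (Or.inl (by linarith [hs.2]))
      refine HasDerivAt.hasDerivWithinAt ?_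
      refine (h2.mul (hf' s ⟨hs.1, hs.2.le⟩)).congr_deriv ?_
      ring)
    ((intervalIntegrable_iff_integrableOn_Icc_of_le hx₀.le).1 hint)
    (fun s hs => by
      have h1 : 0 ≤ (x₀ - s) ^ (-α - 1) := Real.rpow_nonneg (by linarith [hs.2]) _
      have h2 := hnn s hs
      have : 0 ≤ α * (x₀ - s) ^ (-α - 1) * f s := by positivity
      linarith)
  refine h.trans_eq ?_
  simp [hg, hf0]


/-! ### Gamma quotients and convergence of the Mittag-Leffler series -/

/-- Wendel's inequality in the form `Γ(y) / Γ(y + α) ≤ (y + α) ^ (1 - α) / y`. -/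
lemma Gamma_div_Gamma_add_le {α y : ℝ} (hα₀ : 0 < α) (hα₁ : α < 1) (hy : 0 < y) :
    Real.Gamma y / Real.Gamma (y + α) ≤ (y + α) ^ (1 - α) / y := by
  have hya : 0 < y + α := by linarith
  -- Log-convexity of Γ at y + 1 = α(y + α) + (1 - α)(y + α + 1).
  have h := Real.Gamma_mul_add_mul_le_rpow_Gamma_mul_rpow_Gamma hya
    (show 0 < y + α + 1 by linarith) hα₀ (show 0 < 1 - α by linarith) (by ring)
  have hG : 0 < Real.Gamma (y + α) := Real.Gamma_pos_of_pos hya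
  rw [Real.Gamma_add_one hya.ne', Real.mul_rpow hya.le hG.le,
    show α * (y + α) + (1 - α) * (y + α + 1) = y + 1 by ring, Real.Gamma_add_one hy.ne',
    mul_left_comm, ← Real.rpow_add hG, add_sub_cancel, Real.rpow_one] at h
  rw [div_le_div_iff₀ hG hy]
  linarith

lemma tendsto_Gamma_div_Gamma_add {α : ℝ} (hα₀ : 0 < α) (hα₁ : α < 1) :
    Tendsto (fun y => Real.Gamma y / Real.Gamma (y + α)) atTop (𝓝 0) := by
  have hlim : Tendsto (fun y : ℝ => 2 * y ^ (-α)) atTop (𝓝 0) := by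
    simpa using (tendsto_rpow_neg_atTop hα₀).const_mul 2
  refine squeeze_zero' ?_ ?_ hlim
  · filter_upwards [eventually_gt_atTop 0] with y hy
    exact div_nonneg (Real.Gamma_pos_of_pos hy).le (Real.Gamma_pos_of_pos (by linarith)).le
  · filter_upwards [eventually_ge_atTop 1] with y hy
    have hy0 : 0 < y := by linarith
    refine (Gamma_div_Gamma_add_le hα₀ hα₁ hy0).trans ?_
    rw [div_le_iff₀ hy0, mul_assoc, ← Real.rpow_add_one hy0.ne']
    calc (y + α) ^ (1 - α) ≤ (2 * y) ^ (1 - α) :=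
          Real.rpow_le_rpow (by linarith) (by linarith) (by linarith)
      _ = 2 ^ (1 - α) * y ^ (1 - α) := Real.mul_rpow (by norm_num) hy0.le
      _ ≤ 2 ^ (1 : ℝ) * y ^ (1 - α) := by
          gcongr
          · norm_num
          · linarith
      _ = 2 * y ^ (-α + 1) := by rw [Real.rpow_one, neg_add_eq_sub]

section coeff

variable {α : ℝ}

lemma mittagLefflerCoeff_succ (hα₀ : 0 < α) (n : ℕ) :
    mittagLefflerCoeff α (1 + 1 / α) (1 / α) (n + 1) =
      mittagLefflerCoeff α (1 + 1 / α) (1 / α) n *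
        (Real.Gamma ((1 + α) * n + 2) / Real.Gamma ((1 + α) * n + 2 + α)) := by
  rw [mittagLefflerCoeff, Finset.prod_range_succ]
  congr 3
  · field_simp
    ring
  · field_simp
    ring

lemma mittagLefflerCoeff_pos (hα₀ : 0 < α) (n : ℕ) :
    0 < mittagLefflerCoeff α (1 + 1 / α) (1 / α) n := by
  induction n with
  | zero => simp [mittagLefflerCoeff]
  | succ n ih =>
    rw [mittagLefflerCoeff_succ hα₀]
    exact mul_pos ih (div_pos (Real.Gamma_pos_of_pos (by positivity))
      (Real.Gamma_pos_of_pos (by positivity)))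

/-- Ratio test: consecutive coefficients have quotient Γ(y)/Γ(y + α) with y = (1 + α)n + 2, which
tends to 0. -/
lemma entireCoeff_mittagLefflerCoeff (hα₀ : 0 < α) (hα₁ : α < 1) :
    EntireCoeff (mittagLefflerCoeff α (1 + 1 / α) (1 / α)) := by
  intro z
  rcases eq_or_ne z 0 with rfl | hz
  · refine summable_of_ne_finset_zero (s := {0}) fun n hn => ?_
    simp at hn
    simp [hn]
  refine summable_of_ratio_test_tendsto_lt_one zero_lt_one
    (Eventually.of_forall fun n =>
      mul_ne_zero (mittagLefflerCoeff_pos hα₀ n).ne' (pow_ne_zero n hz)) ?_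
  have hy : Tendsto (fun n : ℕ => (1 + α) * n + 2) atTop atTop :=
    tendsto_atTop_add_const_right _ _
      (tendsto_natCast_atTop_atTop.const_mul_atTop (by linarith))
  have h := ((tendsto_Gamma_div_Gamma_add hα₀ hα₁).comp hy).mul_const |z|
  rw [zero_mul] at h
  refine h.congr fun n => ?_
  have hc := mittagLefflerCoeff_pos hα₀ n
  have hG1 : 0 < Real.Gamma ((1 + α) * n + 2) := Real.Gamma_pos_of_pos (by positivity)
  have hG2 : 0 < Real.Gamma ((1 + α) * n + 2 + α) := Real.Gamma_pos_of_pos (by positivity)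
  rw [mittagLefflerCoeff_succ hα₀, pow_succ, norm_mul, norm_mul, norm_mul, norm_mul,
    Real.norm_of_nonneg hc.le, Real.norm_of_nonneg (div_pos hG1 hG2).le, Function.comp_apply,
    Real.norm_eq_abs z]
  have : ‖z ^ n‖ ≠ 0 := norm_ne_zero_iff.2 (pow_ne_zero n hz)
  generalize mittagLefflerCoeff α (1 + 1 / α) (1 / α) n = c at hc
  field_simp

/-- The coefficients of the profile as a power series in `x ^ (1 + α)`. -/
def profileCoeff (α : ℝ) (n : ℕ) : ℝ :=
  mittagLefflerCoeff α (1 + 1 / α) (1 / α) n * (-(1 / (1 + α))) ^ n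

lemma profileCoeff_zero : profileCoeff α 0 = 1 := by simp [profileCoeff, mittagLefflerCoeff]

lemma profileCoeff_succ (hα₀ : 0 < α) (n : ℕ) :
    profileCoeff α (n + 1) = -(1 / (1 + α)) *
      (Real.Gamma ((1 + α) * n + 2) / Real.Gamma ((1 + α) * n + 2 + α)) * profileCoeff α n := by
  rw [profileCoeff, profileCoeff, mittagLefflerCoeff_succ hα₀, pow_succ]
  ring

lemma entireCoeff_profileCoeff (hα₀ : 0 < α) (hα₁ : α < 1) : EntireCoeff (profileCoeff α) := by
  intro z
  refine (entireCoeff_mittagLefflerCoeff hα₀ hα₁ (-(1 / (1 + α)) * z)).congr fun n => ?_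
  rw [profileCoeff, mul_pow]
  ring

lemma selfSimilarProfile_eq (x : ℝ) :
    selfSimilarProfile α x = fracPowerSeries (1 + α) 0 (profileCoeff α) x := by
  rw [fracPowerSeries, Real.rpow_zero, one_mul, selfSimilarProfile, mittagLeffler, powerSeriesSum]
  refine tsum_congr fun n => ?_
  rw [profileCoeff, mul_assoc, ← mul_pow]
  congr 2
  ring

/-- The coefficients of the derivative of the profile, as a power series in `x ^ (1 + α)` times
`x ^ α`. -/
def profileDerivCoeff (α : ℝ) (n : ℕ) : ℝ := (1 + α) * (n + 1) * profileCoeff α (n + 1)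

/-- The derivative of the profile on `(0, ∞)`. -/
def profileDeriv (α : ℝ) : ℝ → ℝ := fracPowerSeries (1 + α) α (profileDerivCoeff α)

/-- The second derivative of the profile on `(0, ∞)`. -/
def profileDeriv2 (α : ℝ) : ℝ → ℝ :=
  fracPowerSeries (1 + α) (α - 1) fun n => (α + (1 + α) * n) * profileDerivCoeff α n

lemma entireCoeff_profileDerivCoeff (hα₀ : 0 < α) (hα₁ : α < 1) :
    EntireCoeff (profileDerivCoeff α) := by
  have h := (entireCoeff_profileCoeff hα₀ hα₁).shift.affine_mul (1 + α) (1 + α)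
  refine fun z => (h z).congr fun n => ?_
  rw [profileDerivCoeff]
  ring

end coeff

/-! ### The profile: equations, sign, monotonicity and decay -/

section profile

variable {α x : ℝ}

/-- Regularity reaches x = 0 because the exponent 1 + α is at least 1; this supplies absolute
continuity up to the boundary. -/
lemma contDiff_selfSimilarProfile (hα₀ : 0 < α) (hα₁ : α < 1) :
    ContDiff ℝ 1 (selfSimilarProfile α) := by
  have h : selfSimilarProfile α = powerSeriesSum (profileCoeff α) ∘ fun x => x ^ (1 + α) := by
    funext x
    rw [selfSimilarProfile_eq, fracPowerSeries, Real.rpow_zero, one_mul, Function.comp_apply]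
  rw [h]
  exact ((entireCoeff_profileCoeff hα₀ hα₁).contDiff 1).comp
    (Real.contDiff_rpow_const_of_le (n := 1) (by push_cast; linarith))

lemma selfSimilarProfile_zero (hα₀ : 0 < α) : selfSimilarProfile α 0 = 1 := by
  rw [selfSimilarProfile_eq, fracPowerSeries, Real.rpow_zero, one_mul,
    Real.zero_rpow (by linarith), powerSeriesSum, tsum_eq_single 0 fun n hn => by simp [hn],
    profileCoeff_zero]
  simp

lemma mul_selfSimilarProfile (x : ℝ) :
    x * selfSimilarProfile α x = fracPowerSeries (1 + α) 1 (profileCoeff α) x := by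
  rw [selfSimilarProfile_eq, fracPowerSeries, fracPowerSeries, Real.rpow_zero, one_mul,
    Real.rpow_one]

lemma hasDerivAt_selfSimilarProfile (hα₀ : 0 < α) (hα₁ : α < 1) (hx : 0 < x) :
    HasDerivAt (selfSimilarProfile α) (profileDeriv α x) x := by
  have ha := entireCoeff_profileCoeff hα₀ hα₁
  rw [show selfSimilarProfile α = _ from funext selfSimilarProfile_eq]
  refine (hasDerivAt_fracPowerSeries ha hx).congr_deriv ?_
  -- The leading term, in x^{-1}, has coefficient 0; removing it raises the exponent to α.
  rw [fracPowerSeries_eq_zero_add (ha.affine_mul _ _) hx, profileDeriv,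
    show 0 - 1 + (1 + α) = α by ring]
  simp only [Nat.cast_zero, mul_zero, add_zero, zero_mul, zero_add]
  refine fracPowerSeries_congr fun n => ?_
  rw [profileDerivCoeff]
  push_cast
  ring

lemma hasDerivAt_profileDeriv (hα₀ : 0 < α) (hα₁ : α < 1) (hx : 0 < x) :
    HasDerivAt (profileDeriv α) (profileDeriv2 α x) x :=
  hasDerivAt_fracPowerSeries (entireCoeff_profileDerivCoeff hα₀ hα₁) hx

lemma continuous_profileDeriv (hα₀ : 0 < α) (hα₁ : α < 1) : Continuous (profileDeriv α) :=
  fracPowerSeries_continuous (entireCoeff_profileDerivCoeff hα₀ hα₁) (by linarith) hα₀.le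

/-- The profile equation at coefficient level: the factor (1 + α)(n + 1) from differentiation is y =
α + (1 + α)n + 1, cancelled by Γ(y + 1) = yΓ(y). -/
lemma Gamma_ratio_mul_profileDerivCoeff (hα₀ : 0 < α) (n : ℕ) :
    Real.Gamma (α + (1 + α) * n + 1) / Real.Gamma ((1 + α) * n + 2) * profileDerivCoeff α n =
      -(1 / (1 + α)) * profileCoeff α n := by
  have h1 : 0 < α + (1 + α) * n + 1 := by positivity
  have hG1 := (Real.Gamma_pos_of_pos h1).ne'
  have hG2 : Real.Gamma ((1 + α) * n + 2) ≠ 0 := (Real.Gamma_pos_of_pos (by positivity)).ne'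
  rw [profileDerivCoeff, profileCoeff_succ hα₀,
    show (1 + α) * n + 2 + α = α + (1 + α) * n + 1 + 1 by ring, Real.Gamma_add_one h1.ne']
  have h2 : (1 + α) * ((n : ℝ) + 1) = α + (1 + α) * n + 1 := by ring
  rw [h2]
  generalize Real.Gamma (α + (1 + α) * n + 1) = G at hG1
  generalize Real.Gamma ((1 + α) * n + 2) = H at hG2
  generalize α + (1 + α) * n + 1 = y at h1
  field_simp

/-- The profile equation `D^α_C Φ = -x Φ / (1 + α)`. -/
lemma fractionalIntegral_profileDeriv (hα₀ : 0 < α) (hα₁ : α < 1) (hx : 0 < x) :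
    fractionalIntegral (1 - α) (profileDeriv α) x =
      -(1 / (1 + α)) * (x * selfSimilarProfile α x) := by
  rw [profileDeriv, fractionalIntegral_fracPowerSeries (entireCoeff_profileDerivCoeff hα₀ hα₁)
    (by linarith) (by linarith) (by linarith) hx, add_sub_cancel, mul_selfSimilarProfile,
    ← fracPowerSeries_const_mul]
  refine fracPowerSeries_congr fun n => ?_
  rw [← Gamma_ratio_mul_profileDerivCoeff hα₀]
  congr 3
  ring

/-- The differentiated profile equation. -/
lemma fractionalIntegral_profileDeriv2 (hα₀ : 0 < α) (hα₁ : α < 1) (hx : 0 < x) :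
    fractionalIntegral (1 - α) (profileDeriv2 α) x =
      -(1 / (1 + α)) * (selfSimilarProfile α x + x * profileDeriv α x) := by
  have ha := entireCoeff_profileCoeff hα₀ hα₁
  have hu : selfSimilarProfile α x + x * profileDeriv α x =
      fracPowerSeries (1 + α) 0 (fun n => (1 + (1 + α) * n) * profileCoeff α n) x := by
    -- The function xΦ is differentiated both as a series and by the product rule; uniqueness of
    -- derivatives identifies the results.
    have h1 := hasDerivAt_fracPowerSeries (β := 1 + α) (q := 1) ha hx
    have h2 := (hasDerivAt_id x).mul (hasDerivAt_selfSimilarProfile hα₀ hα₁ hx)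
    rw [sub_self] at h1
    have h3 : fracPowerSeries (1 + α) 1 (profileCoeff α) = id * selfSimilarProfile α :=
      funext fun y => (mul_selfSimilarProfile y).symm
    rw [h3] at h1
    simpa using h2.unique h1
  rw [hu, profileDeriv2, fractionalIntegral_fracPowerSeries
    ((entireCoeff_profileDerivCoeff hα₀ hα₁).affine_mul _ _)
    (by linarith) (by linarith) (by linarith) hx, ← fracPowerSeries_const_mul,
    show α - 1 + (1 - α) = 0 by ring]
  refine fracPowerSeries_congr fun n => ?_
  have h1 : 0 < α + (1 + α) * n := by positivity
  have h2 : 0 < 1 + (1 + α) * n := by positivity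
  have hG := (Real.Gamma_pos_of_pos h2).ne'
  have hk := Gamma_ratio_mul_profileDerivCoeff hα₀ n
  rw [Real.Gamma_add_one h1.ne', show (1 + α) * n + 2 = 1 + (1 + α) * n + 1 by ring,
    Real.Gamma_add_one h2.ne'] at hk
  rw [show α - 1 + (1 + α) * n + 1 = α + (1 + α) * n by ring,
    show α + (1 + α) * n + (1 - α) = 1 + (1 + α) * n by ring, mul_left_comm (-(1 / (1 + α))), ← hk]
  field_simp

/-- The integral equation `Φ = 1 - I^α (x Φ) / (1 + α)`. -/
lemma fractionalIntegral_mul_selfSimilarProfile (hα₀ : 0 < α) (hα₁ : α < 1) (hx : 0 < x) :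
    fractionalIntegral α (fun s => s * selfSimilarProfile α s) x =
      (1 + α) * (1 - selfSimilarProfile α x) := by
  have ha := entireCoeff_profileCoeff hα₀ hα₁
  rw [show (fun s => s * selfSimilarProfile α s) = _ from funext mul_selfSimilarProfile,
    fractionalIntegral_fracPowerSeries ha (by linarith) hα₀ (by norm_num) hx,
    selfSimilarProfile_eq, fracPowerSeries_eq_zero_add ha hx, profileCoeff_zero, Real.rpow_zero,
    zero_add, one_mul, sub_add_cancel_left, mul_neg, ← neg_mul, ← fracPowerSeries_const_mul]
  refine fracPowerSeries_congr fun n => ?_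
  rw [profileCoeff_succ hα₀, show 1 + (1 + α) * (n : ℝ) + 1 = (1 + α) * n + 2 by ring]
  have : 1 + α ≠ 0 := by linarith
  field_simp

lemma integral_eq_Gamma_mul_fractionalIntegral {γ : ℝ} (hγ : 0 < γ) (f : ℝ → ℝ) (x : ℝ) :
    ∫ s in (0 : ℝ)..x, (x - s) ^ (γ - 1) * f s = Real.Gamma γ * fractionalIntegral γ f x := by
  have := (Real.Gamma_pos_of_pos hγ).ne'
  rw [fractionalIntegral]
  field_simp

/-- At a first zero x₀ the profile equation gives Caputo derivative 0, whereas the extremum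
principle bounds its integral by -x₀^{-α} Φ(0) < 0. -/
lemma selfSimilarProfile_pos (hα₀ : 0 < α) (hα₁ : α < 1) (hx : 0 ≤ x) :
    0 < selfSimilarProfile α x := by
  have hcont := (contDiff_selfSimilarProfile hα₀ hα₁).continuous
  rcases hx.eq_or_lt with rfl | hx
  · rw [selfSimilarProfile_zero hα₀]
    exact one_pos
  by_contra hle
  have hev : ∀ᶠ y in 𝓝[>] (0 : ℝ), 0 < selfSimilarProfile α y :=
    nhdsWithin_le_nhds (continuousAt_const.eventually_lt hcont.continuousAt
      (by rw [selfSimilarProfile_zero hα₀]; exact one_pos))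
  obtain ⟨x₀, hx₀, hzero, hpos⟩ := exists_first_zero hcont.continuousOn hev hx (not_lt.1 hle)
  have hint := intervalIntegrable_sub_rpow_mul_fracPowerSeries
    (entireCoeff_profileDerivCoeff hα₀ hα₁) (show 0 < 1 + α by linarith)
    (show 0 < 1 - α by linarith) (show -1 < α by linarith) hx₀
  have hval := integral_eq_Gamma_mul_fractionalIntegral (show 0 < 1 - α by linarith)
    (profileDeriv α) x₀
  rw [fractionalIntegral_profileDeriv hα₀ hα₁ hx₀, hzero, mul_zero, mul_zero, mul_zero] at hval
  rw [show (1 - α) - 1 = -α by ring] at hint hval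
  have h := integral_sub_rpow_mul_deriv_le hα₀ hα₁ hx₀ hcont.continuousOn
    (fun y hy => hasDerivAt_selfSimilarProfile hα₀ hα₁ hy.1) hzero (fun y hy => (hpos y hy).le) hint
  rw [hval, selfSimilarProfile_zero hα₀, mul_one] at h
  linarith [Real.rpow_pos_of_pos hx₀ (-α)]

/-- At a first zero of -Φ' the extremum principle gives I^{1-α}(-Φ'') ≤ 0, with no boundary term
since Φ'(0) = 0; the differentiated equation gives Φ/(1 + α) > 0. -/
lemma profileDeriv_neg (hα₀ : 0 < α) (hα₁ : α < 1) (hx : 0 < x) : profileDeriv α x < 0 := by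
  have hb := entireCoeff_profileDerivCoeff hα₀ hα₁
  have hcont := continuous_profileDeriv hα₀ hα₁
  by_contra hle
  have hev : ∀ᶠ y in 𝓝[>] (0 : ℝ), 0 < -profileDeriv α y := by
    -- Continuity of Φ' alone gives no sign near 0, where it vanishes; the sign is read off after
    -- factoring out x^α.
    have h0 : powerSeriesSum (profileDerivCoeff α) ((0 : ℝ) ^ (1 + α)) < 0 := by
      rw [Real.zero_rpow (by linarith), powerSeriesSum, tsum_eq_single 0 fun n hn => by simp [hn],
        profileDerivCoeff, profileCoeff_succ hα₀, profileCoeff_zero]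
      have hG1 : 0 < Real.Gamma ((1 + α) * (0 : ℕ) + 2) :=
        Real.Gamma_pos_of_pos (by positivity)
      have hG2 : 0 < Real.Gamma ((1 + α) * (0 : ℕ) + 2 + α) :=
        Real.Gamma_pos_of_pos (by positivity)
      have : 0 < (1 + α) * (((0 : ℕ) : ℝ) + 1) * (1 / (1 + α) * (Real.Gamma ((1 + α) * (0 : ℕ) + 2)
        / Real.Gamma ((1 + α) * (0 : ℕ) + 2 + α))) := by positivity
      rw [pow_zero]
      linarith
    have hc : Continuous fun y : ℝ => powerSeriesSum (profileDerivCoeff α) (y ^ (1 + α)) :=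
      hb.continuous.comp (Real.continuous_rpow_const (by linarith))
    filter_upwards [nhdsWithin_le_nhds (hc.continuousAt.eventually_lt continuousAt_const h0),
      self_mem_nhdsWithin] with y hy hy0
    exact neg_pos.2 (mul_neg_of_pos_of_neg (Real.rpow_pos_of_pos hy0 α) hy)
  obtain ⟨x₀, hx₀, hzero, hpos⟩ := exists_first_zero hcont.neg.continuousOn hev hx
    (neg_nonpos.2 (not_lt.1 hle))
  have hint := (intervalIntegrable_sub_rpow_mul_fracPowerSeries (hb.affine_mul (1 + α) α)
    (show 0 < 1 + α by linarith) (show 0 < 1 - α by linarith) (show -1 < α - 1 by linarith) hx₀).neg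
  have hval := integral_eq_Gamma_mul_fractionalIntegral (show 0 < 1 - α by linarith)
    (profileDeriv2 α) x₀
  rw [fractionalIntegral_profileDeriv2 hα₀ hα₁ hx₀, neg_eq_zero.1 hzero, mul_zero, add_zero] at hval
  rw [show (1 - α) - 1 = -α by ring] at hint hval
  have h := integral_sub_rpow_mul_deriv_le (f := fun y => -profileDeriv α y)
    (f' := fun y => -profileDeriv2 α y) hα₀ hα₁ hx₀ hcont.neg.continuousOn
    (fun y hy => (hasDerivAt_profileDeriv hα₀ hα₁ hy.1).neg) hzero (fun y hy => (hpos y hy).le)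
    (hint.congr fun y _ => by simp [profileDeriv2])
  have h0 : profileDeriv α 0 = 0 := by
    rw [profileDeriv, fracPowerSeries, Real.zero_rpow hα₀.ne', zero_mul]
  simp only [mul_neg, intervalIntegral.integral_neg, hval, h0, neg_zero, mul_zero] at h
  have hG : 0 < Real.Gamma (1 - α) := Real.Gamma_pos_of_pos (by linarith)
  have hΦ := selfSimilarProfile_pos hα₀ hα₁ hx₀.le
  have : 0 < Real.Gamma (1 - α) * (1 / (1 + α) * selfSimilarProfile α x₀) := by positivity
  linarith

lemma strictAntiOn_selfSimilarProfile (hα₀ : 0 < α) (hα₁ : α < 1) :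
    StrictAntiOn (selfSimilarProfile α) (Ici 0) := by
  refine strictAntiOn_of_deriv_neg (convex_Ici 0)
    (contDiff_selfSimilarProfile hα₀ hα₁).continuous.continuousOn fun x hx => ?_
  rw [interior_Ici] at hx
  rw [(hasDerivAt_selfSimilarProfile hα₀ hα₁ hx).deriv]
  exact profileDeriv_neg hα₀ hα₁ hx

/-- Algebraic decay of the profile. -/
lemma exists_selfSimilarProfile_le (hα₀ : 0 < α) (hα₁ : α < 1) :
    ∃ C, ∀ x, 0 < x → selfSimilarProfile α x ≤ C * x ^ (-(1 + α)) := by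
  set B : ℝ := Real.Gamma ((1 : ℝ) + 1) / Real.Gamma ((1 : ℝ) + 1 + α) with hB
  have hBpos : 0 < B :=
    div_pos (Real.Gamma_pos_of_pos (by norm_num)) (Real.Gamma_pos_of_pos (by linarith))
  refine ⟨(1 + α) / B, fun x hx => ?_⟩
  have hG := Real.Gamma_pos_of_pos hα₀
  have h1 := integral_sub_rpow_mul_rpow hα₀ (show (-1 : ℝ) < 1 by norm_num) hx
  have h2 := integral_eq_Gamma_mul_fractionalIntegral hα₀ (fun s => s * selfSimilarProfile α s) x
  rw [fractionalIntegral_mul_selfSimilarProfile hα₀ hα₁ hx] at h2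
  have hint := intervalIntegrable_sub_rpow_mul_rpow hα₀ (show (-1 : ℝ) < 1 by norm_num) hx
  -- By monotonicity Φ(s) ≥ Φ(x) on [0, x], so the integral equation bounds Φ(x) times an explicit
  -- beta integral.
  have hmono := intervalIntegral.integral_mono_on hx.le (hint.const_mul (selfSimilarProfile α x))
    (g := fun s => (x - s) ^ (α - 1) * (s * selfSimilarProfile α s))
    (by
      simpa only [mul_selfSimilarProfile] using intervalIntegrable_sub_rpow_mul_fracPowerSeries
        (entireCoeff_profileCoeff hα₀ hα₁) (show 0 < 1 + α by linarith) hα₀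
        (show (-1 : ℝ) < 1 by norm_num) hx)
    (fun s hs => by
      have h3 : selfSimilarProfile α x ≤ selfSimilarProfile α s :=
        (strictAntiOn_selfSimilarProfile hα₀ hα₁).antitoneOn hs.1 hx.le hs.2
      have h4 : 0 ≤ (x - s) ^ (α - 1) := Real.rpow_nonneg (by linarith [hs.2]) _
      have h5 := hs.1
      rw [Real.rpow_one]
      calc selfSimilarProfile α x * ((x - s) ^ (α - 1) * s)
          = (x - s) ^ (α - 1) * (s * selfSimilarProfile α x) := by ring
        _ ≤ _ := by gcongr)
  rw [intervalIntegral.integral_const_mul, h1, h2] at hmono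
  have hΦ := selfSimilarProfile_pos hα₀ hα₁ hx.le
  have hxp := Real.rpow_pos_of_pos hx (1 + α)
  have h6 : selfSimilarProfile α x * (B * x ^ (1 + α)) ≤ 1 + α := by
    refine le_of_mul_le_mul_left ?_ hG
    calc Real.Gamma α * (selfSimilarProfile α x * (B * x ^ (1 + α)))
        = selfSimilarProfile α x * (Real.Gamma α * B * x ^ (1 + α)) := by ring
      _ ≤ Real.Gamma α * ((1 + α) * (1 - selfSimilarProfile α x)) := hmono
      _ ≤ Real.Gamma α * (1 + α) := by
        gcongr
        nlinarith
  rw [Real.rpow_neg hx.le, ← div_eq_mul_inv, div_div, le_div_iff₀ (by positivity)]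
  exact h6

lemma integrableOn_selfSimilarProfile (hα₀ : 0 < α) (hα₁ : α < 1) :
    IntegrableOn (selfSimilarProfile α) (Ioi 0) := by
  have hcont := (contDiff_selfSimilarProfile hα₀ hα₁).continuous
  obtain ⟨C, hC⟩ := exists_selfSimilarProfile_le hα₀ hα₁
  rw [← Ioc_union_Ioi_eq_Ioi zero_le_one]
  refine IntegrableOn.union hcont.integrableOn_Ioc ?_
  refine Integrable.mono'
    ((integrableOn_Ioi_rpow_of_lt (show -(1 + α) < -1 by linarith) one_pos).const_mul C)
    hcont.aestronglyMeasurable ?_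
  filter_upwards [ae_restrict_mem measurableSet_Ioi] with x hx
  have hx0 : 0 < x := one_pos.trans hx
  rw [Real.norm_of_nonneg (selfSimilarProfile_pos hα₀ hα₁ hx0.le).le]
  exact hC x hx0

lemma integral_selfSimilarProfile_pos (hα₀ : 0 < α) (hα₁ : α < 1) :
    0 < ∫ x in Ioi (0 : ℝ), selfSimilarProfile α x := by
  rw [setIntegral_pos_iff_support_of_nonneg_ae _ (integrableOn_selfSimilarProfile hα₀ hα₁)]
  · have : Ioi (0 : ℝ) ⊆ Function.support (selfSimilarProfile α) := fun x hx =>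
      (selfSimilarProfile_pos hα₀ hα₁ (le_of_lt hx)).ne'
    rw [inter_eq_self_of_subset_right this]
    simp
  · filter_upwards [ae_restrict_mem measurableSet_Ioi] with x hx
    exact (selfSimilarProfile_pos hα₀ hα₁ (le_of_lt hx)).le

end profile


/-! ### Scaling, and the equation for self-similar functions -/

section selfSimilar

variable {α x t : ℝ}

lemma fractionalIntegral_congr {γ : ℝ} {f g : ℝ → ℝ} (hx : 0 ≤ x) (h : ∀ z ∈ Ioc 0 x, f z = g z) :
    fractionalIntegral γ f x = fractionalIntegral γ g x := by
  rw [fractionalIntegral, fractionalIntegral]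
  congr 1
  refine intervalIntegral.integral_congr_ae (Eventually.of_forall fun z hz => ?_)
  rw [uIoc_of_le hx] at hz
  rw [h z hz]

lemma fractionalIntegral_const_mul (γ c : ℝ) (f : ℝ → ℝ) (x : ℝ) :
    fractionalIntegral γ (fun z => c * f z) x = c * fractionalIntegral γ f x := by
  rw [fractionalIntegral, fractionalIntegral, mul_left_comm,
    ← intervalIntegral.integral_const_mul c]
  simp only [mul_left_comm]

lemma fractionalIntegral_comp_mul_left {γ k : ℝ} (hk : 0 < k) (hx : 0 < x) (f : ℝ → ℝ) :
    fractionalIntegral γ (fun z => f (k * z)) x = k ^ (-γ) * fractionalIntegral γ f (k * x) := by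
  have h := intervalIntegral.integral_comp_mul_left (a := 0) (b := x)
    (fun w => (k * x - w) ^ (γ - 1) * f w) hk.ne'
  rw [mul_zero, smul_eq_mul] at h
  have h2 : ∫ z in (0 : ℝ)..x, (k * x - k * z) ^ (γ - 1) * f (k * z) =
      k ^ (γ - 1) * ∫ z in (0 : ℝ)..x, (x - z) ^ (γ - 1) * f (k * z) := by
    rw [← intervalIntegral.integral_const_mul]
    refine intervalIntegral.integral_congr fun z hz => ?_
    rw [uIcc_of_le hx.le] at hz
    rw [← mul_sub, Real.mul_rpow hk.le (by linarith [hz.2]), mul_assoc]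
  rw [h2] at h
  have h3 : k ^ (γ - 1) * k ^ (-γ) = k⁻¹ := by
    rw [← Real.rpow_add hk, ← Real.rpow_neg_one]
    ring_nf
  have h4 : k ^ (γ - 1) ≠ 0 := (Real.rpow_pos_of_pos hk _).ne'
  rw [← h3, mul_assoc] at h
  rw [fractionalIntegral, fractionalIntegral, mul_left_cancel₀ h4 h]
  ring

lemma rpow_scale_pow (hα₀ : 0 < α) (ht : 0 < t) :
    (t ^ (-(1 / (1 + α)))) ^ (1 + α) = t⁻¹ := by
  rw [← Real.rpow_mul ht.le, ← Real.rpow_neg_one]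
  congr 1
  field_simp

/-- Every self-similar function with profile `Φ` is a classical solution. -/
theorem isClassicalSolution_of_selfSimilar (hα₀ : 0 < α) (hα₁ : α < 1) {u : ℝ → ℝ → ℝ} (A : ℝ)
    (hu : ∀ x t, 0 ≤ x → 0 < t → u x t =
      A * t ^ (-(1 / (1 + α))) * selfSimilarProfile α (t ^ (-(1 / (1 + α))) * x)) :
    IsClassicalSolution α u := by
  have hkpos : ∀ t : ℝ, 0 < t → 0 < t ^ (-(1 / (1 + α))) := fun t ht => Real.rpow_pos_of_pos ht _
  have hderiv : ∀ t, 0 < t → ∀ x, 0 < x → deriv (fun y => u y t) x =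
      (A * t ^ (-(1 / (1 + α))) * t ^ (-(1 / (1 + α)))) *
        profileDeriv α (t ^ (-(1 / (1 + α))) * x) := by
    intro t ht x hx
    set k := t ^ (-(1 / (1 + α))) with hk
    have hk0 : 0 < k := hkpos t ht
    have h1 : (fun y => u y t) =ᶠ[𝓝 x] fun y => A * k * selfSimilarProfile α (k * y) := by
      filter_upwards [Ioi_mem_nhds hx] with y hy using hu y t (le_of_lt hy) ht
    have h2 := ((hasDerivAt_selfSimilarProfile hα₀ hα₁ (mul_pos hk0 hx)).comp x
      ((hasDerivAt_id x).const_mul k)).const_mul (A * k)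
    rw [h1.deriv_eq]
    refine h2.deriv.trans ?_
    ring
  have hcaputo : ∀ t, 0 < t → ∀ x, 0 < x → caputoDeriv α (fun y => u y t) x =
      -(1 / (1 + α)) * (A * t ^ (-(1 / (1 + α)))) * t⁻¹ * (x * selfSimilarProfile α (t ^ (-(1 / (1 + α))) * x)) := by
    intro t ht x hx
    have hk1 := rpow_scale_pow hα₀ ht
    have hd := hderiv t ht
    set k := t ^ (-(1 / (1 + α))) with hk
    have hk0 : 0 < k := hkpos t ht
    rw [caputoDeriv, fractionalIntegral_congr hx.le fun z hz => hd z hz.1,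
      fractionalIntegral_const_mul, fractionalIntegral_comp_mul_left hk0 hx,
      fractionalIntegral_profileDeriv hα₀ hα₁ (mul_pos hk0 hx)]
    -- One k is in the amplitude, one comes from the chain rule, k^{-(1-α)} from the fractional
    -- integral and one more from kx; the last k returns to the amplitude and the others combine to
    -- k^{1+α} = 1/t.
    have h2 : k * k * k ^ (-(1 - α)) = t⁻¹ := by
      rw [← hk1, show 1 + α = 1 + 1 + -(1 - α) by ring, Real.rpow_add hk0, Real.rpow_add hk0,
        Real.rpow_one]
    calc A * k * k * (k ^ (-(1 - α)) * (-(1 / (1 + α)) * (k * x * selfSimilarProfile α (k * x))))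
        = -(1 / (1 + α)) * (A * k) * (k * k * k ^ (-(1 - α))) *
          (x * selfSimilarProfile α (k * x)) := by ring
      _ = _ := by rw [h2]
  have hcaputo_deriv : ∀ x t, 0 < x → 0 < t → HasDerivAt (caputoDeriv α (fun y => u y t))
      (-(1 / (1 + α)) * (A * t ^ (-(1 / (1 + α)))) * t⁻¹ * (selfSimilarProfile α (t ^ (-(1 / (1 + α))) * x) +
        x * (profileDeriv α (t ^ (-(1 / (1 + α))) * x) * t ^ (-(1 / (1 + α)))))) x := by
    intro x t hx ht
    refine HasDerivAt.congr_of_eventuallyEq ?_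
      (eventually_of_mem (Ioi_mem_nhds hx) fun y hy => hcaputo t ht y hy)
    have h2 := (hasDerivAt_selfSimilarProfile hα₀ hα₁ (mul_pos (hkpos t ht) hx)).comp x
      ((hasDerivAt_id x).const_mul (t ^ (-(1 / (1 + α)))))
    refine (((hasDerivAt_id x).mul h2).const_mul _).congr_deriv ?_
    simp
  have htime : ∀ x t, 0 < x → 0 < t → HasDerivAt (fun s => u x s)
      (-(1 / (1 + α)) * (A * t ^ (-(1 / (1 + α)))) * t⁻¹ * (selfSimilarProfile α (t ^ (-(1 / (1 + α))) * x) +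
        x * (profileDeriv α (t ^ (-(1 / (1 + α))) * x) * t ^ (-(1 / (1 + α)))))) t := by
    intro x t hx ht
    have h1 : (fun s => u x s) =ᶠ[𝓝 t] fun s => A * s ^ (-(1 / (1 + α))) *
        selfSimilarProfile α (s ^ (-(1 / (1 + α))) * x) := by
      filter_upwards [Ioi_mem_nhds ht] with s hs using hu x s hx.le hs
    refine HasDerivAt.congr_of_eventuallyEq ?_ h1
    have h2 := Real.hasDerivAt_rpow_const (p := -(1 / (1 + α))) (Or.inl ht.ne')
    -- Writing the power as k/t makes the claim an identity in k and 1/t, matching the x-derivative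
    -- of the Caputo derivative.
    rw [Real.rpow_sub_one ht.ne'] at h2
    have h3 := (hasDerivAt_selfSimilarProfile hα₀ hα₁ (mul_pos (hkpos t ht) hx)).comp t
      (h2.mul_const x)
    refine ((h2.const_mul A).mul h3).congr_deriv ?_
    rw [Function.comp_apply]
    generalize t ^ (-(1 / (1 + α))) = k
    ring
  refine ⟨fun t ht L hL => ?_, fun t ht x hx => ?_,
    fun x t hx ht => (htime x t hx ht).differentiableAt,
    fun x t hx ht => (hcaputo_deriv x t hx ht).differentiableAt, fun x t hx ht => ?_⟩
  · refine ContDiffOn.absolutelyContinuousOnInterval ?_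
    refine ContDiffOn.congr (f := fun y => A * t ^ (-(1 / (1 + α))) *
      selfSimilarProfile α (t ^ (-(1 / (1 + α))) * y)) ?_ fun y hy => ?_
    · exact (contDiff_const.mul ((contDiff_selfSimilarProfile hα₀ hα₁).comp
        (contDiff_const.mul contDiff_id))).contDiffOn
    · rw [uIcc_of_le hL.le] at hy
      exact hu y t hy.1 ht
  · have h := (intervalIntegrable_sub_rpow_mul_rpow (γ := 1 - α) (p := 0)
      (by linarith) (by norm_num) hx).mul_continuousOn
      (g := fun z => (A * t ^ (-(1 / (1 + α))) * t ^ (-(1 / (1 + α)))) *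
        profileDeriv α (t ^ (-(1 / (1 + α))) * z))
      (continuous_const.mul ((continuous_profileDeriv hα₀ hα₁).comp
        (continuous_const.mul continuous_id))).continuousOn
    refine h.congr fun z hz => ?_
    rw [uIoc_of_le hx.le] at hz
    rw [hderiv t ht z hz.1, Real.rpow_zero, mul_one]
  · rw [(htime x t hx ht).deriv, (hcaputo_deriv x t hx ht).deriv, sub_self]

lemma fundamentalSol_eq (hα₀ : 0 < α) (hx : 0 ≤ x) (ht : 0 < t) :
    fundamentalSol α x t = normalizingConst α * t ^ (-(1 / (1 + α))) *
      selfSimilarProfile α (t ^ (-(1 / (1 + α))) * x) := by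
  rw [fundamentalSol, selfSimilarProfile, Real.mul_rpow (Real.rpow_nonneg ht.le _) hx,
    rpow_scale_pow hα₀ ht]
  congr 2
  field_simp

lemma fundamentalSol_scale (hα₀ : 0 < α) {r : ℝ} (hr : 0 < r) (hx : 0 ≤ x) (ht : 0 < t) :
    fundamentalSol α (r ^ (1 / (1 + α)) * x) (r * t) =
      r ^ (-(1 / (1 + α))) * fundamentalSol α x t := by
  rw [fundamentalSol_eq hα₀ (mul_nonneg (Real.rpow_nonneg hr.le _) hx) (mul_pos hr ht),
    fundamentalSol_eq hα₀ hx ht, Real.mul_rpow hr.le ht.le,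
    show r ^ (-(1 / (1 + α))) * t ^ (-(1 / (1 + α))) * (r ^ (1 / (1 + α)) * x) =
      t ^ (-(1 / (1 + α))) * x * (r ^ (-(1 / (1 + α))) * r ^ (1 / (1 + α))) by ring,
    ← Real.rpow_add hr, neg_add_cancel, Real.rpow_zero, mul_one]
  ring

/-- The Mittag-Leffler function is smooth on the whole line, so only the powers of x and t, smooth
away from 0, restrict the domain. -/
lemma contDiffOn_fundamentalSol (hα₀ : 0 < α) (hα₁ : α < 1) :
    ContDiffOn ℝ 2 (fun p : ℝ × ℝ => fundamentalSol α p.1 p.2) (Ioi 0 ×ˢ Ioi 0) := by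
  have hE : ContDiff ℝ 2 (mittagLeffler α (1 + 1 / α) (1 / α)) :=
    (entireCoeff_mittagLefflerCoeff hα₀ hα₁).contDiff 2
  refine (contDiffOn_const.mul (contDiffOn_snd.rpow_const_of_ne fun p hp => ne_of_gt hp.2)).mul
    (hE.comp_contDiffOn ((contDiffOn_fst.rpow_const_of_ne fun p hp => ne_of_gt hp.1).neg.div
      (contDiffOn_const.mul contDiffOn_snd) fun p hp => ?_))
  have : 0 < p.2 := hp.2
  positivity

lemma normalizingConst_pos (hα₀ : 0 < α) (hα₁ : α < 1) : 0 < normalizingConst α :=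
  one_div_pos.2 (mul_pos two_pos (integral_selfSimilarProfile_pos hα₀ hα₁))

end selfSimilar

end

theorem theorem3p1 (α : ℝ) (hα₀ : 0 < α) (hα₁ : α < 1) :
    -- the series defining the Mittag-Leffler function converges everywhere
    (∀ z : ℝ, Summable fun n : ℕ => mittagLefflerCoeff α (1 + 1 / α) (1 / α) n * z ^ n) ∧
    -- the constant `a₀` is well defined: the integral in its definition is finite and positive
    IntegrableOn (selfSimilarProfile α) (Ioi 0) ∧
    0 < ∫ x in Ioi (0 : ℝ), selfSimilarProfile α x ∧
    -- (1) `𝓔` is of class `C²`, a classical solution, and self-similar: it is invariant under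
    -- the scaling of the equation, and its rescalings are again solutions
    ContDiffOn ℝ 2 (fun p : ℝ × ℝ => fundamentalSol α p.1 p.2) (Ioi 0 ×ˢ Ioi 0) ∧
    IsClassicalSolution α (fundamentalSol α) ∧
    (∀ r : ℝ, 0 < r → ∀ x t : ℝ, 0 < x → 0 < t →
      r ^ (1 / (1 + α)) * fundamentalSol α (r ^ (1 / (1 + α)) * x) (r * t)
        = fundamentalSol α x t) ∧
    (∀ r : ℝ, 0 < r →
      IsClassicalSolution α (fun x t => fundamentalSol α (r ^ (1 / (1 + α)) * x) (r * t))) ∧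
    -- (2) positivity
    (∀ x t : ℝ, 0 < x → 0 < t → 0 < fundamentalSol α x t) ∧
    -- (3) monotonicity in `x`
    (∀ t : ℝ, 0 < t → StrictAntiOn (fun x => fundamentalSol α x t) (Ioi 0)) ∧
    -- (4) integrability in `x` and the value of the integral
    (∀ t : ℝ, 0 < t →
      IntegrableOn (fun x => fundamentalSol α x t) (Ioi 0) ∧
      ∫ x in Ioi (0 : ℝ), fundamentalSol α x t = 1 / 2) := by
  have hk : ∀ t : ℝ, 0 < t → 0 < t ^ (-(1 / (1 + α))) := fun t ht => Real.rpow_pos_of_pos ht _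
  have hA := normalizingConst_pos hα₀ hα₁
  have hI := integral_selfSimilarProfile_pos hα₀ hα₁
  refine ⟨entireCoeff_mittagLefflerCoeff hα₀ hα₁, integrableOn_selfSimilarProfile hα₀ hα₁, hI,
    contDiffOn_fundamentalSol hα₀ hα₁,
    isClassicalSolution_of_selfSimilar hα₀ hα₁ _ fun x t hx ht => fundamentalSol_eq hα₀ hx ht,
    fun r hr x t hx ht => ?_, fun r hr => ?_, fun x t hx ht => ?_, fun t ht x hx y hy hxy => ?_,
    fun t ht => ?_⟩
  · rw [fundamentalSol_scale hα₀ hr hx.le ht, ← mul_assoc, ← Real.rpow_add hr, add_neg_cancel,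
      Real.rpow_zero, one_mul]
  · refine isClassicalSolution_of_selfSimilar hα₀ hα₁
      (r ^ (-(1 / (1 + α))) * normalizingConst α) fun x t hx ht => ?_
    rw [fundamentalSol_scale hα₀ hr hx ht, fundamentalSol_eq hα₀ hx ht]
    ring
  · rw [fundamentalSol_eq hα₀ hx.le ht]
    have hkt := hk t ht
    exact mul_pos (mul_pos hA hkt) (selfSimilarProfile_pos hα₀ hα₁ (mul_pos hkt hx).le)
  · have hx0 : 0 < x := hx
    have hy0 : 0 < y := hy
    have hkt := hk t ht
    simp only [fundamentalSol_eq hα₀ hx0.le ht, fundamentalSol_eq hα₀ hy0.le ht]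
    exact mul_lt_mul_of_pos_left (strictAntiOn_selfSimilarProfile hα₀ hα₁
      (mul_pos hkt hx0).le (mul_pos hkt hy0).le (mul_lt_mul_of_pos_left hxy hkt)) (mul_pos hA hkt)
  · have hkt := hk t ht
    have heq : EqOn (fun x => fundamentalSol α x t) (fun x => normalizingConst α *
        t ^ (-(1 / (1 + α))) * selfSimilarProfile α (t ^ (-(1 / (1 + α))) * x)) (Ioi 0) :=
      fun x hx => fundamentalSol_eq hα₀ (le_of_lt hx) ht
    constructor
    · refine IntegrableOn.congr_fun (Integrable.const_mul ?_ _) heq.symm measurableSet_Ioi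
      refine (integrableOn_Ioi_comp_mul_left_iff _ 0 hkt).2 ?_
      rw [mul_zero]
      exact integrableOn_selfSimilarProfile hα₀ hα₁
    -- The Jacobian of the dilation cancels the amplitude factor in t, leaving a₀ ∫Φ.
    · rw [setIntegral_congr_fun measurableSet_Ioi heq, integral_const_mul,
        integral_comp_mul_left_Ioi _ 0 hkt, mul_zero, smul_eq_mul, normalizingConst]
      field_simp
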